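/- Let $A$ and $B$ be $n\times n$ complex matrices. Write $X_A(M)=AM$ and $\Delta_B(M)=B\circ M$ (entrywise product) for the corresponding linear operators on $n\times n$ complex matrices. The pair $(A,B)$ is a *one-sided Jones pair* if $X_A$ and $\Delta_B$ are invertible and $X_A\Delta_BX_A=\Delta_BX_A\Delta_B$; it is a *Jones pair* if $(A,B)$ and $(A,B^T)$ are both one-sided Jones pairs, and an *invertible Jones pair* if moreover every entry of $A$ is nonzero and $B$ is invertible. For a matrix $U$ with no zero entry let $U^{(-)}$ be its entrywise inverse, and let its Nomura algebra $\mathcal N_U$ be the set of all complex matrices $M$ for which every vector $Ue_i\circ U^{(-)}e_j$ is an eigenvector. Suppose that $(A,B)$ is an invertible Jones pair and that $A$ is symmetric, and put $$W=\begin{pmatrix}A^T&-A^T\\ (B^{(-)})^T&(B^{(-)})^T\end{pmatrix}.$$ Let $\pi$ be the partition of $\{1,\dots,2n\}$ into the cells $C_i=\{i,n+i\}$, $i=1,\dots,n$, and let $S$ be its $2n\times n$ characteristic matrix ($S_{h,k}=1$ if $h\in C_k$, and $0$ otherwise). Then $\pi$ is equitable relative to $\mathcal N_{W^T}$, that is,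 for each $M\in\mathcal N_{W^T}$ there is an $n\times n$ matrix $B_M$ (necessarily unique) with $MS=SB_M$; and the quotient of $\mathcal N_{W^T}$ with respect to $\pi$ is $\mathcal N_A$: $$\{B_M : M\in\mathcal N_{W^T}\}=\mathcal N_A.$$ -/

import Mathlib

open scoped Matrix

namespace JonesPair

variable {ι κ : Type*}

/-- The operator `X_A : M ↦ A M` on complex square matrices. -/
def X [Fintype ι] [DecidableEq ι] (A : Matrix ι ι ℂ) :
    Module.End ℂ (Matrix ι ι ℂ) :=
  LinearMap.mulLeft ℂ A

/-- The operator `Δ_B : M ↦ B ∘ M` (entrywise product) on complex square matrices. -/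
def Δ (B : Matrix ι ι ℂ) : Module.End ℂ (Matrix ι ι ℂ) where
  toFun M := B ⊙ M
  map_add' M N := Matrix.hadamard_add B M N
  map_smul' c M := Matrix.hadamard_smul B M c

/-- `A` is Schur invertible: no entry vanishes. -/
def IsSchurInvertible (A : Matrix ι κ ℂ) : Prop :=
  ∀ i j, A i j ≠ 0

/-- The Schur inverse `A⁽⁻⁾`, the entrywise inverse. -/
noncomputable def schurInv (A : Matrix ι κ ℂ) : Matrix ι κ ℂ :=
  Matrix.of fun i j => (A i j)⁻¹

/-- One-sided Jones pair: `X_A` and `Δ_B` are invertible operators and satisfy the braid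
relation `X_A Δ_B X_A = Δ_B X_A Δ_B`. -/
structure IsOneSidedJonesPair [Fintype ι] [DecidableEq ι] (A B : Matrix ι ι ℂ) : Prop where
  isUnit_X : IsUnit (X A)
  isUnit_Δ : IsUnit (Δ B)
  braid : X A * Δ B * X A = Δ B * X A * Δ B

/-- Jones pair: both `(A, B)` and `(A, Bᵀ)` are one-sided Jones pairs. -/
structure IsJonesPair [Fintype ι] [DecidableEq ι] (A B : Matrix ι ι ℂ) : Prop where
  left : IsOneSidedJonesPair A B
  right : IsOneSidedJonesPair A Bᵀ

/-- Invertible Jones pair: moreover `A` is Schur invertible and `B` is invertible. -/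
structure IsInvertibleJonesPair [Fintype ι] [DecidableEq ι] (A B : Matrix ι ι ℂ) : Prop where
  isJonesPair : IsJonesPair A B
  isSchurInvertible : IsSchurInvertible A
  isUnit : IsUnit B

/-- `N_{A,B}`: the matrices that have every vector `A e_i ∘ B e_j` as an eigenvector. -/
def nomuraPair [Fintype ι] (A B : Matrix ι κ ℂ) : Set (Matrix ι ι ℂ) :=
  {M | ∀ i j, ∃ c : ℂ, M *ᵥ (A.col i * B.col j) = c • (A.col i * B.col j)}

/-- The Nomura algebra `N_A` of a Schur invertible matrix `A`: the matrices that have every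
vector `A e_i ∘ A⁽⁻⁾ e_j` as an eigenvector. (These vectors have no zero entry.) -/
noncomputable def nomura [Fintype ι] (A : Matrix ι ι ℂ) : Set (Matrix ι ι ℂ) :=
  nomuraPair A (schurInv A)

/-- The matrix `W` with block rows `(Aᵀ, -Aᵀ)` and `(B⁽⁻⁾ᵀ, B⁽⁻⁾ᵀ)`. -/
noncomputable def matW (A B : Matrix ι ι ℂ) : Matrix (ι ⊕ ι) (ι ⊕ ι) ℂ :=
  Matrix.fromBlocks Aᵀ (-Aᵀ) (schurInv B)ᵀ (schurInv B)ᵀ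

/-- The characteristic matrix of a partition with cells `s k`: the entry at `(i, k)` is `1` if
`i` lies in the cell `s k`, and `0` otherwise. -/
noncomputable def charMatrix {s : κ → Set ι} (_π : IndexedPartition s) : Matrix ι κ ℂ :=
  Matrix.of fun i k => (s k).indicator 1 i

/-- `Q` is the quotient of `M` with respect to the partition: `M S = S Q`. It is unique, as the
cells are nonempty. -/
def IsMatrixQuotient [Fintype ι] [Fintype κ] {s : κ → Set ι} (π : IndexedPartition s)
    (M : Matrix ι ι ℂ) (Q : Matrix κ κ ℂ) : Prop :=
  M * charMatrix π = charMatrix π * Q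

/-- The partition is equitable relative to `𝓑`: every `M ∈ 𝓑` has a quotient. -/
def IsEquitable [Fintype ι] [Fintype κ] {s : κ → Set ι} (π : IndexedPartition s)
    (𝓑 : Set (Matrix ι ι ℂ)) : Prop :=
  ∀ M ∈ 𝓑, ∃ Q, IsMatrixQuotient π M Q

/-- The quotient of `𝓑`: the set of the quotients of its members. -/
def quotient [Fintype ι] [Fintype κ] {s : κ → Set ι} (π : IndexedPartition s)
    (𝓑 : Set (Matrix ι ι ℂ)) : Set (Matrix κ κ ℂ) :=
  {Q | ∃ M ∈ 𝓑, IsMatrixQuotient π M Q}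

/-- The cell `{i, n + i}`; the index `i` is `Sum.inl i` and `n + i` is `Sum.inr i`. -/
def pairCell (i : ι) : Set (ι ⊕ ι) :=
  {Sum.inl i, Sum.inr i}

/-- The partition of the `2n` indices into the cells `{i, n + i}`. -/
def pairPartition (ι : Type*) : IndexedPartition (pairCell (ι := ι)) where
  eq_of_mem := by
    rintro (x | x) i j hi hj <;> simp_all [pairCell]
  some := Sum.inl
  some_mem i := by simp [pairCell]
  index := Sum.elim id id
  mem_index := by
    rintro (x | x) <;> simp [pairCell]

end JonesPair

namespace JonesPair

open Matrix

/-! ### Eigenvectors defining the Nomura algebra of `(matW A B)ᵀ` -/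

section Basic

variable {ι : Type*}

/-! The vectors defining the Nomura algebra of `(matW A B)ᵀ` are either doubled, `(v, v)`, with `v`
a Nomura vector of `A` or of `B`, or of the form `(v, -v)`. On doubled vectors from `A`, the two
block row sums of a member act by the same scalar. These `v` span, because `A` is type II, so the
row sums agree, and their common value is a quotient lying in `nomura A` (`eq_of_mulVec_eq`).

Conversely, the matrix with all four blocks `N/2` has quotient `N`, acts as `N` on doubled vectors
and kills every `(v, -v)`. It is a member once `N` lies in both `nomura A` and `nomura B`, so the
crux is `nomura A ⊆ nomura B` (`IsInvertibleJonesPair.nomura_subset`). There the braid relation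
shows that `B` carries ratios of rows of `B` to multiples of ratios of rows of `A`. Conjugation by
`B` thus transports the transposed eigenvalue matrix of a member of `nomura A`, and type II
orthogonality inverts the passage from a matrix to its eigenvalues. -/

lemma isSchurInvertible_of_isUnit_Δ {B : Matrix ι ι ℂ} (h : IsUnit (Δ B)) :
    IsSchurInvertible B := by
  intro i j hij
  obtain ⟨M, hM⟩ := ((Module.End.isUnit_iff _).1 h).2 (Matrix.of fun _ _ => 1)
  have := congrFun (congrFun hM i) j
  simp [Δ, hij] at this

lemma mem_nomura_iff [Fintype ι] {C M : Matrix ι ι ℂ} :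
    M ∈ nomura C ↔ ∃ S : Matrix ι ι ℂ, ∀ l i j,
      ∑ k, M l k * (C k i * (C k j)⁻¹) = S i j * (C l i * (C l j)⁻¹) := by
  constructor
  · intro h
    choose S hS using h
    exact ⟨S, fun l i j => congrFun (hS i j) l⟩
  · rintro ⟨S, hS⟩ i j
    exact ⟨S i j, funext fun l => hS l i j⟩

lemma charMatrix_pairPartition [DecidableEq ι] : charMatrix (pairPartition ι) = fromRows 1 1 := by
  ext (i | i) k <;> simp [charMatrix, pairCell, Set.indicator_apply, one_apply]

lemma nomura_vector_inl_inl (A B : Matrix ι ι ℂ) (i j : ι) :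
    (matW A B)ᵀ.col (Sum.inl i) * (schurInv (matW A B)ᵀ).col (Sum.inl j) =
      Sum.elim (A.col i * (schurInv A).col j) (A.col i * (schurInv A).col j) := by
  ext (k | k) <;> simp [matW, schurInv]

/-- The lower blocks hold inverses of entries of `B`, hence the exchange of `i` and `j`. -/
lemma nomura_vector_inr_inr (A B : Matrix ι ι ℂ) (i j : ι) :
    (matW A B)ᵀ.col (Sum.inr i) * (schurInv (matW A B)ᵀ).col (Sum.inr j) =
      Sum.elim (B.col j * (schurInv B).col i) (B.col j * (schurInv B).col i) := by
  ext (k | k) <;> simp [matW, schurInv, mul_comm]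

lemma nomura_vector_inl_inr (A B : Matrix ι ι ℂ) (i j : ι) :
    (matW A B)ᵀ.col (Sum.inl i) * (schurInv (matW A B)ᵀ).col (Sum.inr j) =
      Sum.elim (A.col i * B.col j) (-(A.col i * B.col j)) := by
  ext (k | k) <;> simp [matW, schurInv]

lemma nomura_vector_inr_inl (A B : Matrix ι ι ℂ) (i j : ι) :
    (matW A B)ᵀ.col (Sum.inr i) * (schurInv (matW A B)ᵀ).col (Sum.inl j) =
      Sum.elim ((schurInv B).col i * (schurInv A).col j)
        (-((schurInv B).col i * (schurInv A).col j)) := by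
  ext (k | k) <;> simp [matW, schurInv, inv_neg]

/-- The row sums of the blocks of a member of `N_{Wᵀ}` act by a common scalar on each
`A e_i ∘ A⁽⁻⁾ e_j`. -/
lemma exists_eigenvalue_of_fromBlocks_mem [Fintype ι] {A B P Q R T : Matrix ι ι ℂ}
    (h : fromBlocks P Q R T ∈ nomura (matW A B)ᵀ) (i j : ι) :
    ∃ c : ℂ, (P + Q) *ᵥ (A.col i * (schurInv A).col j) = c • (A.col i * (schurInv A).col j) ∧
      (R + T) *ᵥ (A.col i * (schurInv A).col j) = c • (A.col i * (schurInv A).col j) := by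
  obtain ⟨c, hc⟩ := h (Sum.inl i) (Sum.inl j)
  rw [nomura_vector_inl_inl, fromBlocks_mulVec] at hc
  refine ⟨c, ?_, ?_⟩
  · ext k
    simpa [add_mulVec] using congrFun hc (Sum.inl k)
  · ext k
    simpa [add_mulVec] using congrFun hc (Sum.inr k)

lemma fromBlocks_mem_nomura [Fintype ι] {A B N : Matrix ι ι ℂ}
    (hNA : N ∈ nomura A) (hNB : N ∈ nomura B) :
    fromBlocks ((2⁻¹ : ℂ) • N) ((2⁻¹ : ℂ) • N) ((2⁻¹ : ℂ) • N) ((2⁻¹ : ℂ) • N) ∈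
      nomura (matW A B)ᵀ := by
  have hadd : ∀ v w : ι → ℂ,
      fromBlocks ((2⁻¹ : ℂ) • N) ((2⁻¹ : ℂ) • N) ((2⁻¹ : ℂ) • N) ((2⁻¹ : ℂ) • N) *ᵥ
        Sum.elim v w = Sum.elim ((2⁻¹ : ℂ) • N *ᵥ (v + w)) ((2⁻¹ : ℂ) • N *ᵥ (v + w)) := by
    intro v w
    rw [fromBlocks_mulVec]
    simp [smul_mulVec, mulVec_add]
  have hsym : ∀ (v : ι → ℂ) (c : ℂ), N *ᵥ v = c • v →
      fromBlocks ((2⁻¹ : ℂ) • N) ((2⁻¹ : ℂ) • N) ((2⁻¹ : ℂ) • N) ((2⁻¹ : ℂ) • N) *ᵥ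
        Sum.elim v v = c • Sum.elim v v := by
    intro v c hv
    rw [hadd, mulVec_add, hv]
    ext (k | k) <;> simp <;> ring
  have hanti : ∀ v : ι → ℂ,
      fromBlocks ((2⁻¹ : ℂ) • N) ((2⁻¹ : ℂ) • N) ((2⁻¹ : ℂ) • N) ((2⁻¹ : ℂ) • N) *ᵥ
        Sum.elim v (-v) = (0 : ℂ) • Sum.elim v (-v) := by
    intro v
    rw [hadd]
    ext (k | k) <;> simp
  rintro (i | i) (j | j)
  · obtain ⟨c, hc⟩ := hNA i j
    exact ⟨c, by rw [nomura_vector_inl_inl]; exact hsym _ _ hc⟩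
  · exact ⟨0, by rw [nomura_vector_inl_inr]; exact hanti _⟩
  · exact ⟨0, by rw [nomura_vector_inr_inl]; exact hanti _⟩
  · obtain ⟨c, hc⟩ := hNB j i
    exact ⟨c, by rw [nomura_vector_inr_inr]; exact hsym _ _ hc⟩

end Basic

/-! ### Type II property of both matrices, and comparison of their Nomura algebras -/

section Nomura

variable {ι : Type*} [Fintype ι] [DecidableEq ι]

/-- A type II matrix: `C` is Schur invertible and `C C⁽⁻⁾ᵀ = n I`. -/
structure IsTypeII (C : Matrix ι ι ℂ) : Prop where
  isSchurInvertible : IsSchurInvertible C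
  row_sum : ∀ k m, ∑ i, C k i * (C m i)⁻¹ = if k = m then (Fintype.card ι : ℂ) else 0

lemma isUnit_of_isUnit_X {A : Matrix ι ι ℂ} (h : IsUnit (X A)) : IsUnit A := by
  obtain ⟨M, hM⟩ := ((Module.End.isUnit_iff _).1 h).2 (1 : Matrix ι ι ℂ)
  exact IsUnit.of_mul_eq_one M hM

/-- The braid relation, column by column of `B`. -/
lemma IsOneSidedJonesPair.mul_diagonal_mul {A B : Matrix ι ι ℂ}
    (h : IsOneSidedJonesPair A B) (j : ι) :
    A * diagonal (B.col j) * A = diagonal (B.col j) * A * diagonal (B.col j) := by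
  ext l i
  -- On matrices supported in column `j`, `Δ B` is left multiplication by `diagonal (B.col j)`.
  have := congrFun (congrFun (LinearMap.congr_fun h.braid (Matrix.single i j 1)) l) j
  simp only [X, Δ, Module.End.mul_apply, LinearMap.mulLeft_apply, LinearMap.coe_mk,
    AddHom.coe_mk, mul_apply, hadamard_apply, single_apply] at this
  simpa [mul_apply, diagonal_apply, ite_and, mul_assoc, mul_comm, mul_left_comm] using this

/-- The braid relation entrywise. -/
lemma IsOneSidedJonesPair.sum_mul {A B : Matrix ι ι ℂ}
    (h : IsOneSidedJonesPair A B) (l i j : ι) :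
    ∑ k, A l k * B k j * A k i = B l j * A l i * B i j := by
  have := congrFun (congrFun (h.mul_diagonal_mul j) l) i
  simpa [mul_apply, diagonal_apply] using this

/-- `D_j⁻¹ A D_j = A D_j A⁻¹` entrywise. -/
lemma IsOneSidedJonesPair.sum_mul_inv {A B : Matrix ι ι ℂ}
    (h : IsOneSidedJonesPair A B) (l m j : ι) :
    ∑ k, A l k * B k j * A⁻¹ k m = A l m * B m j * (B l j)⁻¹ := by
  have hA := (Matrix.isUnit_iff_isUnit_det A).1 (isUnit_of_isUnit_X h.isUnit_X)
  have hB := isSchurInvertible_of_isUnit_Δ h.isUnit_Δ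
  set D := diagonal (B.col j)
  set E := diagonal (fun i => (B i j)⁻¹)
  have hED : E * D = 1 := by
    simp [E, D, diagonal_mul_diagonal, hB _ j]
  have hDE : D * E = 1 := mul_eq_one_comm.1 hED
  have hb : A * D * A = D * A * D := h.mul_diagonal_mul j
  have key : A * D * A⁻¹ = E * A * D := by
    have h1 : A * (E * A * D) * A = A * (A * D * A⁻¹) * A := by
      have hAE : E * (A * D * A) = A * D := by
        rw [hb, ← mul_assoc, ← mul_assoc, hED, one_mul]
      calc A * (E * A * D) * A = A * (E * (A * D * A)) := by simp only [mul_assoc]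
        _ = A * (A * D * A⁻¹) * A := by
          rw [hAE]
          simp only [mul_assoc, nonsing_inv_mul A hA, mul_one]
    have h2 := congrArg (fun N => A⁻¹ * N * A⁻¹) h1
    simp only [mul_assoc, mul_nonsing_inv A hA, mul_one] at h2
    simp only [← mul_assoc, nonsing_inv_mul A hA, one_mul] at h2
    exact h2.symm
  have := congrFun (congrFun key l) m
  simp [mul_apply, diagonal_apply, D, E] at this
  rw [this]; ring

/-- Every column of `B` sums to the trace of `A`. -/
lemma IsOneSidedJonesPair.col_sum {A B : Matrix ι ι ℂ}
    (h : IsOneSidedJonesPair A B) (j : ι) : ∑ k, B k j = A.trace := by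
  have hA := (Matrix.isUnit_iff_isUnit_det A).1 (isUnit_of_isUnit_X h.isUnit_X)
  have hB := isSchurInvertible_of_isUnit_Δ h.isUnit_Δ
  -- Take traces in `A D_j A⁻¹ = D_j⁻¹ A D_j`.
  have h1 : ∑ m, ∑ k, A m k * B k j * A⁻¹ k m = ∑ k, B k j := by
    rw [Finset.sum_comm]
    refine Finset.sum_congr rfl fun k _ => ?_
    have := congrFun (congrFun (nonsing_inv_mul A hA) k) k
    rw [mul_apply, one_apply_eq] at this
    calc _ = B k j * ∑ m, A⁻¹ k m * A m k := by
          rw [Finset.mul_sum]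
          exact Finset.sum_congr rfl fun m _ => by ring
      _ = B k j := by rw [this, mul_one]
  rw [← h1, trace]
  refine Finset.sum_congr rfl fun m _ => ?_
  rw [h.sum_mul_inv, mul_assoc, mul_inv_cancel₀ (hB m j), mul_one, diag_apply]

lemma IsOneSidedJonesPair.trace_ne_zero {A B : Matrix ι ι ℂ} [Nonempty ι]
    (h : IsOneSidedJonesPair A B) (hB : IsUnit B) : A.trace ≠ 0 := by
  intro h0
  have hinj := Matrix.vecMul_injective_iff_isUnit.2 hB
  have h1 : (fun _ => 1 : ι → ℂ) ᵥ* B = 0 ᵥ* B := by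
    ext j
    simp [vecMul, dotProduct, h.col_sum, h0]
  have := congrFun (hinj h1) (Classical.arbitrary ι)
  simp at this

/-- The diagonal of `A D_j A⁻¹ = D_j⁻¹ A D_j` does not depend on `j`. So the row vector `(A l k *
A⁻¹ k l)_k` has constant image under `B`, as does the all-ones vector. Since `B` is invertible, the
vector is constant, and its entries sum to `1`. -/
lemma IsOneSidedJonesPair.mul_inv_entry {A B : Matrix ι ι ℂ}
    (h : IsOneSidedJonesPair A B) (hB : IsUnit B) (l k : ι) :
    A l k * A⁻¹ k l = (Fintype.card ι : ℂ)⁻¹ := by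
  have : Nonempty ι := ⟨l⟩
  have hA := (Matrix.isUnit_iff_isUnit_det A).1 (isUnit_of_isUnit_X h.isUnit_X)
  have hS := isSchurInvertible_of_isUnit_Δ h.isUnit_Δ
  have ht := h.trace_ne_zero hB
  have hinj := Matrix.vecMul_injective_iff_isUnit.2 hB
  have h1 : (fun k => A l k * A⁻¹ k l) ᵥ* B = (fun _ => A l l / A.trace) ᵥ* B := by
    ext j
    have h2 := h.sum_mul_inv l l j
    rw [mul_assoc, mul_inv_cancel₀ (hS l j), mul_one] at h2
    simp only [vecMul, dotProduct]
    rw [← Finset.mul_sum, h.col_sum, div_mul_cancel₀ _ ht, ← h2]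
    exact Finset.sum_congr rfl fun k _ => by ring
  have h3 : ∀ k, A l k * A⁻¹ k l = A l l / A.trace := congrFun (hinj h1)
  have h4 := congrFun (congrFun (mul_nonsing_inv A hA) l) l
  rw [mul_apply, one_apply_eq, Finset.sum_congr rfl fun k _ => h3 k, Finset.sum_const,
    nsmul_eq_mul, Finset.card_univ] at h4
  rw [h3]
  exact eq_inv_of_mul_eq_one_right h4

lemma IsInvertibleJonesPair.isTypeII_left {A B : Matrix ι ι ℂ}
    (h : IsInvertibleJonesPair A B) : IsTypeII A where
  isSchurInvertible := h.isSchurInvertible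
  row_sum k m := by
    have : Nonempty ι := ⟨k⟩
    have hn : (Fintype.card ι : ℂ) ≠ 0 := by exact_mod_cast Fintype.card_ne_zero
    have hA := (Matrix.isUnit_iff_isUnit_det A).1 (isUnit_of_isUnit_X h.isJonesPair.left.isUnit_X)
    have h1 : ∀ i, (A m i)⁻¹ = Fintype.card ι * A⁻¹ i m := fun i => by
      have := h.isJonesPair.left.mul_inv_entry h.isUnit m i
      refine (eq_inv_of_mul_eq_one_right ?_).symm
      rw [mul_left_comm, this, mul_inv_cancel₀ hn]
    have h2 := congrFun (congrFun (mul_nonsing_inv A hA) k) m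
    rw [mul_apply, one_apply] at h2
    simp only [h1]
    calc _ = (Fintype.card ι : ℂ) * ∑ i, A k i * A⁻¹ i m := by
          rw [Finset.mul_sum]; exact Finset.sum_congr rfl fun i _ => by ring
      _ = _ := by rw [h2]; split_ifs <;> simp

lemma IsInvertibleJonesPair.isTypeII_right {A B : Matrix ι ι ℂ}
    (h : IsInvertibleJonesPair A B) : IsTypeII B where
  isSchurInvertible := isSchurInvertible_of_isUnit_Δ h.isJonesPair.left.isUnit_Δ
  row_sum m l := by
    have : Nonempty ι := ⟨l⟩
    have hl := h.isJonesPair.left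
    have hS := isSchurInvertible_of_isUnit_Δ hl.isUnit_Δ
    have hA := (Matrix.isUnit_iff_isUnit_det A).1 (isUnit_of_isUnit_X hl.isUnit_X)
    by_cases hml : m = l
    · subst hml
      simp [hS m _]
    rw [if_neg hml]
    have h1 : A l m * ∑ j, B m j * (B l j)⁻¹ = 0 := by
      -- Row sums of `B` are column sums of `Bᵀ`: here the second one-sided pair enters.
      have hrow : ∀ k, ∑ j, B k j = A.trace := h.isJonesPair.right.col_sum
      have h2 := congrFun (congrFun (mul_nonsing_inv A hA) l) m
      rw [mul_apply, one_apply_ne (Ne.symm hml)] at h2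
      calc _ = ∑ j, ∑ k, A l k * B k j * A⁻¹ k m := by
            rw [Finset.mul_sum]
            exact Finset.sum_congr rfl fun j _ => by rw [hl.sum_mul_inv]; ring
        _ = ∑ k, A l k * A⁻¹ k m * ∑ j, B k j := by
            rw [Finset.sum_comm]
            refine Finset.sum_congr rfl fun k _ => ?_
            rw [Finset.mul_sum]
            exact Finset.sum_congr rfl fun j _ => by ring
        _ = 0 := by simp only [hrow, ← Finset.sum_mul, h2, zero_mul]
    exact (mul_eq_zero.1 h1).resolve_left (h.isSchurInvertible l m)

lemma IsTypeII.col_sum {C : Matrix ι ι ℂ} (h : IsTypeII C) (j k : ι) :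
    ∑ l, C l j * (C l k)⁻¹ = if j = k then (Fintype.card ι : ℂ) else 0 := by
  have : Nonempty ι := ⟨j⟩
  have hn : (Fintype.card ι : ℂ) ≠ 0 := by exact_mod_cast Fintype.card_ne_zero
  have h1 : C * ((Fintype.card ι : ℂ)⁻¹ • (schurInv C)ᵀ) = 1 := by
    ext k m
    simp only [Matrix.smul_apply, mul_apply, transpose_apply, schurInv, of_apply, one_apply,
      smul_eq_mul, mul_left_comm (C k _), ← Finset.mul_sum, h.row_sum k m]
    split_ifs <;> simp [hn]
  have h1' := mul_eq_one_comm.1 h1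
  have h2 := congrFun (congrFun h1' k) j
  simp only [Matrix.smul_apply, mul_apply, transpose_apply, schurInv, of_apply, one_apply,
    smul_eq_mul, mul_assoc, ← Finset.mul_sum] at h2
  rw [inv_mul_eq_iff_eq_mul₀ hn] at h2
  simp only [mul_comm (C _ j), h2, eq_comm (a := j)]
  split_ifs <;> simp

/-- The vectors `(B_lj / B_mj)_j` are mapped by `B` to multiples of `(A_mi / A_li)_i`. -/
lemma IsInvertibleJonesPair.sum_mul_div {A B : Matrix ι ι ℂ}
    (h : IsInvertibleJonesPair A B) (i l m : ι) :
    ∑ j, B i j * (B l j * (B m j)⁻¹) =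
      Fintype.card ι * A l m * (A m i * (A l i)⁻¹) := by
  have hB := h.isTypeII_right
  -- The factor `A l i` completes the right side of the braid relation; orthogonality of the rows of
  -- `B` then leaves only `k = m`.
  have h1 : A l i * ∑ j, B i j * (B l j * (B m j)⁻¹) = Fintype.card ι * (A l m * A m i) := by
    calc _ = ∑ j, (∑ k, A l k * B k j * A k i) * (B m j)⁻¹ := by
          rw [Finset.mul_sum]
          exact Finset.sum_congr rfl fun j _ => by rw [h.isJonesPair.left.sum_mul]; ring
      _ = ∑ k, A l k * A k i * ∑ j, B k j * (B m j)⁻¹ := by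
          simp only [Finset.sum_mul, Finset.mul_sum]
          rw [Finset.sum_comm]
          exact Finset.sum_congr rfl fun k _ => Finset.sum_congr rfl fun j _ => by ring
      _ = _ := by simp [hB.row_sum, mul_comm]
  refine mul_left_cancel₀ (h.isSchurInvertible l i) (h1.trans ?_)
  have hne := h.isSchurInvertible l i
  field_simp

/-- If `S` is the matrix of eigenvalues of `M ∈ N_C`, then `Sᵀ ∈ N_{Cᵀ}` with eigenvalues
`n M`. -/
lemma IsTypeII.sum_eigenvalue {C M S : Matrix ι ι ℂ} (hC : IsTypeII C)
    (hS : ∀ l i j, ∑ k, M l k * (C k i * (C k j)⁻¹) = S i j * (C l i * (C l j)⁻¹))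
    (j l m : ι) :
    ∑ i, S i j * (C l i * (C m i)⁻¹) = Fintype.card ι * M l m * (C l j * (C m j)⁻¹) := by
  calc _ = C l j * ∑ i, (∑ k, M l k * (C k i * (C k j)⁻¹)) * (C m i)⁻¹ := by
        rw [Finset.mul_sum]
        refine Finset.sum_congr rfl fun i _ => ?_
        rw [hS]
        have := hC.isSchurInvertible l j
        field_simp
    _ = C l j * ∑ k, M l k * (C k j)⁻¹ * ∑ i, C k i * (C m i)⁻¹ := by
        simp only [Finset.sum_mul, Finset.mul_sum]
        rw [Finset.sum_comm]
        exact Finset.sum_congr rfl fun k _ => Finset.sum_congr rfl fun j _ => by ring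
    _ = _ := by simp [hC.row_sum]; ring

/-- The inverse transform of `IsTypeII.sum_eigenvalue`. -/
lemma IsTypeII.mem_nomura_of_sum_eigenvalue {C M U : Matrix ι ι ℂ} (hC : IsTypeII C)
    (hU : ∀ i l m, ∑ j, U i j * (C l j * (C m j)⁻¹) =
      Fintype.card ι * M m l * (C l i * (C m i)⁻¹)) : M ∈ nomura C := by
  refine mem_nomura_iff.2 ⟨U, fun m i k => ?_⟩
  have : Nonempty ι := ⟨m⟩
  have hn : (Fintype.card ι : ℂ) ≠ 0 := by exact_mod_cast Fintype.card_ne_zero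
  -- Weighting by `(C l k)⁻¹` and summing over `l` isolates `j = k`, by orthogonality of columns.
  have h1 : ∑ l, (∑ j, U i j * (C l j * (C m j)⁻¹)) * (C l k)⁻¹ =
      Fintype.card ι * (U i k * (C m k)⁻¹) := by
    calc _ = ∑ j, U i j * (C m j)⁻¹ * ∑ l, C l j * (C l k)⁻¹ := by
          simp only [Finset.sum_mul, Finset.mul_sum]
          rw [Finset.sum_comm]
          exact Finset.sum_congr rfl fun k _ => Finset.sum_congr rfl fun j _ => by ring
      _ = _ := by simp [hC.col_sum]; ring
  simp only [hU] at h1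
  have h2 : ∑ l, Fintype.card ι * M m l * (C l i * (C m i)⁻¹) * (C l k)⁻¹ =
      Fintype.card ι * ((C m i)⁻¹ * ∑ l, M m l * (C l i * (C l k)⁻¹)) := by
    simp only [Finset.mul_sum]
    exact Finset.sum_congr rfl fun k _ => by ring
  rw [h2] at h1
  have h3 := mul_left_cancel₀ hn h1
  rw [inv_mul_eq_iff_eq_mul₀ (hC.isSchurInvertible m i)] at h3
  rw [h3]; ring

/-- For an invertible Jones pair, the Nomura algebra of `A` lies in that of `B`. -/
lemma IsInvertibleJonesPair.nomura_subset {A B : Matrix ι ι ℂ}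
    (h : IsInvertibleJonesPair A B) : nomura A ⊆ nomura B := by
  intro M hM
  obtain ⟨S, hS⟩ := mem_nomura_iff.1 hM
  have hA := h.isTypeII_left
  have hB := h.isTypeII_right
  have hdet := (Matrix.isUnit_iff_isUnit_det B).1 h.isUnit
  -- `Sᵀ` has the eigenvector `v` with eigenvalue `n M m l`, and `B *ᵥ u` is a multiple of `v`, so
  -- the conjugate has `u` with the same eigenvalue.
  refine hB.mem_nomura_of_sum_eigenvalue (U := B⁻¹ * Sᵀ * B) fun i l m => ?_
  set u : ι → ℂ := fun j => B l j * (B m j)⁻¹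
  set v : ι → ℂ := fun j => A m j * (A l j)⁻¹
  have h1 : B *ᵥ u = (Fintype.card ι * A l m) • v :=
    funext fun i => h.sum_mul_div i l m
  have h2 : Sᵀ *ᵥ v = (Fintype.card ι * M m l) • v :=
    funext fun j => hA.sum_eigenvalue hS j m l
  have h3 : (B⁻¹ * Sᵀ * B) *ᵥ u = (Fintype.card ι * M m l) • u := by
    rw [← mulVec_mulVec, h1, ← mulVec_mulVec, mulVec_smul, h2, smul_comm, ← h1, mulVec_smul,
      mulVec_mulVec, nonsing_inv_mul B hdet, one_mulVec]
  exact congrFun h3 i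

end Nomura

/-! ### Quotients of block matrices, and the theorem -/

section Quotient

variable {ι : Type*} [Fintype ι] [DecidableEq ι]

lemma isMatrixQuotient_fromBlocks {P Q R T N : Matrix ι ι ℂ} :
    IsMatrixQuotient (pairPartition ι) (fromBlocks P Q R T) N ↔ P + Q = N ∧ R + T = N := by
  rw [IsMatrixQuotient, charMatrix_pairPartition, fromBlocks_mul_fromRows, fromRows_mul,
    fromRows_inj.eq_iff]
  simp

/-- A matrix is determined by its values on the vectors `C e_i ∘ C⁽⁻⁾ e_j`. -/
lemma eq_of_mulVec_eq {C M N : Matrix ι ι ℂ} (hC : IsTypeII C)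
    (h : ∀ i j, M *ᵥ (C.col i * (schurInv C).col j) = N *ᵥ (C.col i * (schurInv C).col j)) :
    M = N := by
  ext l m
  have : Nonempty ι := ⟨l⟩
  have hn : (Fintype.card ι : ℂ) ≠ 0 := by exact_mod_cast Fintype.card_ne_zero
  -- With weights `(C m i)⁻¹`, the vectors `C e_i ∘ C⁽⁻⁾ e_m` sum over `i` to a nonzero multiple of
  -- `e_m`.
  have key : ∀ K : Matrix ι ι ℂ,
      ∑ i, (∑ k, K l k * (C k i * (C k m)⁻¹)) * (C m i)⁻¹ =
        Fintype.card ι * (K l m * (C m m)⁻¹) := fun K => by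
    calc _ = ∑ k, K l k * (C k m)⁻¹ * ∑ i, C k i * (C m i)⁻¹ := by
          simp only [Finset.sum_mul, Finset.mul_sum]
          rw [Finset.sum_comm]
          exact Finset.sum_congr rfl fun k _ => Finset.sum_congr rfl fun j _ => by ring
      _ = _ := by simp [hC.row_sum]; ring
  have h1 : ∀ i, ∑ k, M l k * (C k i * (C k m)⁻¹) = ∑ k, N l k * (C k i * (C k m)⁻¹) :=
    fun i => congrFun (h i m) l
  have h2 := (key M).symm.trans ((by simp only [h1]) : _ = _) |>.trans (key N)
  exact mul_right_cancel₀ (inv_ne_zero (hC.isSchurInvertible m m)) (mul_left_cancel₀ hn h2)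

end Quotient

end JonesPair

open JonesPair in
theorem mainTheorem6 (n : ℕ) (A B : Matrix (Fin n) (Fin n) ℂ)
    (hAB : JonesPair.IsInvertibleJonesPair A B) (hA : A.IsSymm) :
    JonesPair.IsEquitable (JonesPair.pairPartition (Fin n))
        (JonesPair.nomura (JonesPair.matW A B)ᵀ) ∧
      JonesPair.quotient (JonesPair.pairPartition (Fin n))
        (JonesPair.nomura (JonesPair.matW A B)ᵀ) = JonesPair.nomura A := by
  refine ⟨fun M hM => ?_, Set.Subset.antisymm ?_ fun N hN => ?_⟩
  · rw [← Matrix.fromBlocks_toBlocks M] at hM ⊢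
    refine ⟨_, isMatrixQuotient_fromBlocks.2 ⟨rfl, ?_⟩⟩
    refine eq_of_mulVec_eq hAB.isTypeII_left fun i j => ?_
    obtain ⟨c, h₁, h₂⟩ := exists_eigenvalue_of_fromBlocks_mem hM i j
    rw [h₁, h₂]
  · rintro N ⟨M, hM, hN⟩ i j
    rw [← Matrix.fromBlocks_toBlocks M] at hM hN
    obtain ⟨c, h₁, -⟩ := exists_eigenvalue_of_fromBlocks_mem hM i j
    exact ⟨c, by rw [← (isMatrixQuotient_fromBlocks.1 hN).1]; exact h₁⟩
  -- The preimage of `N` has all four blocks equal to `N/2`.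
  · refine ⟨_, fromBlocks_mem_nomura hN (hAB.nomura_subset hN),
      isMatrixQuotient_fromBlocks.2 ⟨?_, ?_⟩⟩ <;>
    rw [← add_smul] <;> norm_num
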